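/- Let $p$ be a prime and $k\ge 2$, put $g_i=p^i-1$, and let $ku_*=\mathbb Z_{(p)}[v]$. For $n\ge 1$ write $[p^n](x)=\sum_{t=0}^{p^n-1}a_{t,n}x^{t+1}$ with $a_{t,n}=\binom{p^n}{t+1}v^t$. Let $F=\bigoplus_{i\ge1}ku_*\,\alpha_i$ be the free $ku_*$-module on $\alpha_1,\alpha_2,\dots$ (with $\alpha_h=0$ for $h\le 0$), and let $ku_*(\mathbb Z_{p^2})$ be the $ku_*$-module with generators $e_j$, $j\ge1$ (with $e_h=0$ for $h\le0$), and relations $\sum_{t=0}^{p^2-1}a_{t,2}\,e_{j-t}=0$ for $j\ge1$ (the reduced $p$-local $ku$-homology of $\mathbb Z_{p^2}$). In $N=F\otimes_{ku_*}ku_*(\mathbb Z_{p^2})$ write $[i,j]=\alpha_i\otimes e_j$, and let $\partial_{k+1}\colon N\to N$ be the $ku_*$-linear map with $$\partial_{k+1}[i,j]=\sum_{t=0}^{p^{k+1}-1}a_{t,k+1}\,[i-t,j].$$ Filter $N$ by letting $F_wN$ be the $ku_*$-span of all $[i,j]$, $i,j\ge1$, of weight $|[i,j]|=i(p^{k+1}+1)+j(p^k+1)\le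 w$. Consider the spectral sequence of the filtered two-term complex $0\to N\xrightarrow{\ \partial_{k+1}\ }N\to0$; on the source of $\partial_{k+1}$ its $r$-th page is $E^r_w=Z^r_w/Z^{r-1}_{w-1}$ with $Z^r_w=\{x\in F_wN:\partial_{k+1}x\in F_{w-r}N\}$, on the target it is $E^r_w=F_wN/(F_{w-1}N+\partial_{k+1}Z^{r-1}_{w+r-1})$, and $d^r\colon E^r_w\to E^r_{w-r}$ is induced by $\partial_{k+1}$. Then for every $a\ge1$: 1. There is an element $\mathrm{low}$ of filtration strictly lower than that of $[a,kg_1]$, i.e. $\mathrm{low}\in F_{w-1}N$ for $w=|[a,kg_1]|$, such that $$\partial_{k+1}\bigl([a,kg_1]+\mathrm{low}\bigr)=0.$$ 2. Hence the elements $[a,kg_1]$, and their images $[a,b]$, $1\le b\le kg_1$, under the shifts $[i,j]\mapsto[i,j-s]$, support no differentials: for every such $b$, the class of $[a,b]$ in the source of $\partial_{k+1}$ is a permanent cycle, i.e. for every $r\ge0$ it survives to $E^r$ and $d^r$ vanishes on it. -/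

import Mathlib

open scoped TensorProduct

noncomputable section

namespace KuSS

instance isPrime_span_natCast (p : ℕ) [hp : Fact p.Prime] :
    (Ideal.span {(p : ℤ)}).IsPrime :=
  (Ideal.span_singleton_prime (by exact_mod_cast hp.out.ne_zero)).2
    (Nat.prime_iff_prime_int.1 hp.out)

/-- The ring `ℤ_(p)` of `p`-local integers. -/
def PLocal (p : ℕ) [Fact p.Prime] : Type :=
  Localization.AtPrime (Ideal.span {(p : ℤ)})

instance (p : ℕ) [Fact p.Prime] : CommRing (PLocal p) :=
  inferInstanceAs (CommRing (Localization.AtPrime (Ideal.span {(p : ℤ)})))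

/-- The `p`-local coefficient ring `ku_* = ℤ_(p)[v]`. -/
def Ku (p : ℕ) [Fact p.Prime] : Type := Polynomial (PLocal p)

instance (p : ℕ) [Fact p.Prime] : CommRing (Ku p) :=
  inferInstanceAs (CommRing (Polynomial (PLocal p)))

/-- The generator `v` of `ku_2`. -/
def v (p : ℕ) [Fact p.Prime] : Ku p := (Polynomial.X : Polynomial (PLocal p))

/-- `g_i = p ^ i - 1`. -/
def g (p i : ℕ) : ℕ := p ^ i - 1

/-- The coefficient `a_{t,n} = (p ^ n choose t + 1) v ^ t` of the `[p ^ n]`-series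
`[p ^ n](x) = ∑_{t < p ^ n} a_{t,n} x ^ (t + 1)`. -/
def coeffA (p : ℕ) [Fact p.Prime] (n t : ℕ) : Ku p :=
  ((p ^ n).choose (t + 1) : Ku p) * v p ^ t

/-- The free `ku_*`-module `F` on generators `α_i`, `i ≥ 1`. -/
abbrev F (p : ℕ) [Fact p.Prime] : Type := ℕ+ →₀ Ku p

/-- The generator `α_h`, with the convention `α_h = 0` for `h ≤ 0`. -/
def alpha (p : ℕ) [Fact p.Prime] (h : ℤ) : F p :=
  if 0 < h then Finsupp.single h.toNat.toPNat' 1 else 0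

/-- The `ku_*`-linear map `F → F`, `α_i ↦ ∑_{t < p ^ n} a_{t,n} α_{i - t}`. -/
def seriesMap (p : ℕ) [Fact p.Prime] (n : ℕ) : F p →ₗ[Ku p] F p :=
  Finsupp.linearCombination (Ku p) fun i : ℕ+ =>
    ∑ t ∈ Finset.range (p ^ n), coeffA p n t • alpha p ((i : ℤ) - t)

/-- The reduced `ku`-homology `ku_*(ℤ_{p ^ n})`: generators `e_j`, `j ≥ 1`, and the relations
`∑_{t < p ^ n} a_{t,n} e_{j - t} = 0` for `j ≥ 1`, where `e_h = 0` for `h ≤ 0`. -/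
abbrev KuHom (p : ℕ) [Fact p.Prime] (n : ℕ) : Type :=
  F p ⧸ LinearMap.range (seriesMap p n)

/-- The generator `e_j` of `ku_*(ℤ_{p ^ n})`. -/
def e (p : ℕ) [Fact p.Prime] (n : ℕ) (j : ℤ) : KuHom p n :=
  (LinearMap.range (seriesMap p n)).mkQ (alpha p j)

/-- The module `F ⊗ ku_*(ℤ_{p ^ n})` in both nonzero places of the complex. -/
def N (p : ℕ) [Fact p.Prime] (n : ℕ) : Type := F p ⊗[Ku p] KuHom p n

instance (p : ℕ) [Fact p.Prime] (n : ℕ) : AddCommGroup (N p n) :=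
  inferInstanceAs (AddCommGroup (F p ⊗[Ku p] KuHom p n))

instance (p : ℕ) [Fact p.Prime] (n : ℕ) : Module (Ku p) (N p n) :=
  inferInstanceAs (Module (Ku p) (F p ⊗[Ku p] KuHom p n))

/-- The element `[i, j] = α_i ⊗ e_j`. -/
def bracket (p : ℕ) [Fact p.Prime] (n : ℕ) (i j : ℤ) : N p n :=
  alpha p i ⊗ₜ[Ku p] e p n j

/-- The map `∂_m` on `F ⊗ ku_*(ℤ_{p ^ n})`, given by the `[p ^ m]`-series on the first factor. -/
def bd (p : ℕ) [Fact p.Prime] (n m : ℕ) : N p n →ₗ[Ku p] N p n :=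
  (seriesMap p m).rTensor (KuHom p n)

theorem bd_bracket (p : ℕ) [Fact p.Prime] (n m : ℕ) (i j : ℤ) (hi : 0 < i) :
    bd p n m (bracket p n i j) =
      ∑ t ∈ Finset.range (p ^ m), coeffA p m t • bracket p n (i - t) j := by
  have h1 : ((i.toNat.toPNat' : ℕ+) : ℤ) = i := by
    have h2 : 0 < i.toNat := by omega
    rw [Nat.toPNat'_coe, if_pos h2]
    omega
  have h3 : seriesMap p m (alpha p i) =
      ∑ t ∈ Finset.range (p ^ m), coeffA p m t • alpha p (i - t) := by
    conv_lhs => rw [alpha, if_pos hi]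
    rw [seriesMap, Finsupp.linearCombination_single, one_smul, h1]
  have h4 : (seriesMap p m (alpha p i)) ⊗ₜ[Ku p] e p n j =
      ∑ t ∈ Finset.range (p ^ m), (coeffA p m t • alpha p (i - t)) ⊗ₜ[Ku p] e p n j := by
    rw [h3, TensorProduct.sum_tmul]
  exact h4

/-- The filtration weight of `[i, j]`: `|α_i| = i (p ^ (k + 1) + 1)`, `|e_j| = j (p ^ k + 1)`. -/
def weight (p k : ℕ) (i j : ℤ) : ℤ :=
  i * ((p : ℤ) ^ (k + 1) + 1) + j * ((p : ℤ) ^ k + 1)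

/-- Filtration at most `w`: the `ku_*`-span of the `[i, j]` with `i, j ≥ 1` of weight at most `w`
(coefficients in `ku_*` have filtration `0`). -/
def fil (p : ℕ) [Fact p.Prime] (n k : ℕ) (w : ℤ) : Submodule (Ku p) (N p n) :=
  Submodule.span (Ku p)
    {x | ∃ i j : ℤ, 1 ≤ i ∧ 1 ≤ j ∧ weight p k i j ≤ w ∧ x = bracket p n i j}

/-! The spectral sequence of the filtered two-term complex given by `∂_{k+1}`. -/

/-- `Z^r_w`: elements of the source of filtration at most `w` whose boundary has filtration at
most `w - r`. -/
def cyc (p : ℕ) [Fact p.Prime] (n k : ℕ) (r w : ℤ) : Submodule (Ku p) (N p n) :=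
  fil p n k w ⊓ (fil p n k (w - r)).comap (bd p n (k + 1))

/-- What is divided out of `F_w` in the target to form the `r`-th page:
`F_{w-1} + ∂ Z^{r-1}_{w+r-1}`. -/
def bdry (p : ℕ) [Fact p.Prime] (n k : ℕ) (r w : ℤ) : Submodule (Ku p) (N p n) :=
  fil p n k (w - 1) ⊔ (cyc p n k (r - 1) (w + r - 1)).map (bd p n (k + 1))

/-- The page `E^r_w` at the source of `∂_{k+1}`: `Z^r_w / Z^{r-1}_{w-1}`. -/
abbrev ESrc (p : ℕ) [Fact p.Prime] (n k : ℕ) (r w : ℤ) : Type :=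
  cyc p n k r w ⧸ (cyc p n k (r - 1) (w - 1)).submoduleOf (cyc p n k r w)

/-- The page `E^r_w` at the target of `∂_{k+1}`: `F_w / (F_{w-1} + ∂ Z^{r-1}_{w+r-1})`. -/
abbrev ETgt (p : ℕ) [Fact p.Prime] (n k : ℕ) (r w : ℤ) : Type :=
  fil p n k w ⧸ (bdry p n k r w).submoduleOf (fil p n k w)

/-- `∂_{k+1}` as a map `Z^r_w → F_{w-r}`. -/
def bdCyc (p : ℕ) [Fact p.Prime] (n k : ℕ) (r w : ℤ) :
    cyc p n k r w →ₗ[Ku p] fil p n k (w - r) :=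
  (bd p n (k + 1)).restrict fun _ hx => hx.2

/-- The differential `d^r : E^r_w → E^r_{w-r}` induced by `∂_{k+1}`. -/
def diff (p : ℕ) [Fact p.Prime] (n k : ℕ) (r w : ℤ) :
    ESrc p n k r w →ₗ[Ku p] ETgt p n k r (w - r) :=
  Submodule.mapQ _ _ (bdCyc p n k r w) (by
    intro x hx
    have hx' : (x : N p n) ∈ cyc p n k (r - 1) (w - 1) := hx
    change bd p n (k + 1) (x : N p n) ∈ bdry p n k r (w - r)
    refine Submodule.mem_sup_right (Submodule.mem_map_of_mem ?_)
    have hw : w - r + r - 1 = w - 1 := by ring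
    rwa [hw])

/-- The class of `x` in filtration `w` is a permanent cycle: for every `r ≥ 0` the class of `x`
modulo lower filtration survives to `E^r`, i.e. it has a representative `z` in `Z^r_w`, and `d^r`
vanishes on the resulting class in `E^r_w` (which does not depend on the choice of `z`). -/
def IsPermanentCycle (p : ℕ) [Fact p.Prime] (n k : ℕ) (w : ℤ) (x : N p n) : Prop :=
  x ∈ fil p n k w ∧
    ∀ r : ℕ, ∃ z : cyc p n k r w, (z : N p n) - x ∈ fil p n k (w - 1) ∧
      diff p n k r w (Submodule.Quotient.mk z) = 0

end KuSS

end

/-!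
Let `X` and `Y` be the shifts `[i, j] ↦ [i - 1, j]` and `[i, j] ↦ [i, j - 1]` of `N`, and put
`u = 1 + v X`, `w = 1 + v Y`. Then `∂_{k+1}` is the geometric sum `1 + u + ⋯ + u ^ (p ^ (k+1) - 1)`
(`bd_eq_geom_sum`), and the relations of `ku_*(ℤ_{p ^ 2})` say that
`1 + w + ⋯ + w ^ (p ^ 2 - 1) = 0` (`geom_sum_opY`).

Think of `w` as a root of unity of order `p` or `p ^ 2`. In both cases the solutions of
`u ^ (p ^ i) = w ^ c` with `0 ≤ i < k` and `1 ≤ c < p` are distinct nontrivial roots of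
`u ^ (p ^ (k+1)) = 1`, so the product of the `k (p - 1)` elements `u ^ (p ^ i) - w ^ c` should divide
`∂_{k+1}`. Because this product is monic in `u`, the divisibility holds over the integers
(`prod_dvd_geom_sum`). Moreover `u ^ (p ^ i) - w ^ c` is `v` times `[p ^ i](X) - [c](Y)`, so every
element of `N` that is killed by the product of the operators `[p ^ i](X) - [c](Y)` is a cycle.

The operator `[p ^ i](X) - [c](Y)` is `-c Y` plus terms that lower the weight by more than `Y` does
(`lowers_seriesSub_add`), and `c` is a unit of `ℤ_(p)`. It is therefore surjective, with control of
the filtration (`fil_le_map`), and solving one equation for each factor gives, for every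
`b ≤ k (p - 1)`, an element `[a, b] + low` that is killed by the product of the first `b` factors
(`exists_low_prod_eq_zero`). This is the required cycle, and it makes `[a, b]` a permanent cycle.
-/

/-! ### Divisibility of geometric sums -/

namespace KuSS
open Polynomial

/-- The nontrivial powers of a primitive `p`-th root of unity are distinct roots of
`1 + X + ⋯ + X ^ (p - 1)`; here `U` is substituted for `X`. -/
theorem prod_sub_pow_dvd_geom_sum {p : ℕ} (hp : p.Prime) {η : ℂ} (hη : IsPrimitiveRoot η p)
    (U : ℂ[X]) :
    (∏ c ∈ Finset.range (p - 1), (U - C (η ^ (c + 1)))) ∣ ∑ s ∈ Finset.range p, U ^ s := by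
  have key : (∏ c ∈ Finset.range (p - 1), (X - C (η ^ (c + 1)) : ℂ[X])) ∣
      ∑ s ∈ Finset.range p, (X : ℂ[X]) ^ s := by
    refine Finset.prod_dvd_of_coprime ?_ ?_
    · intro i hi j hj hij
      refine isCoprime_X_sub_C_of_isUnit_sub (isUnit_iff_ne_zero.2 (sub_ne_zero.2 fun h => hij ?_))
      simp only [Finset.coe_range, Set.mem_Iio] at hi hj
      have := hη.pow_inj (by omega) (by omega) h
      omega
    · intro c hc
      simp only [Finset.mem_range] at hc
      rw [dvd_iff_isRoot, IsRoot, eval_finsetSum]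
      simp only [eval_pow, eval_X]
      have hcop : (c + 1).Coprime p :=
        (Nat.coprime_of_lt_prime (by omega) (by omega) hp).symm
      exact (hη.pow_of_coprime _ hcop).geom_sum_eq_zero hp.one_lt
  have h := map_dvd (compRingHom U) key
  simpa only [map_prod, map_sum, map_sub, map_pow, coe_compRingHom_apply, X_comp, C_comp] using h

/-- The geometric sum of length `p ^ m` is a product of geometric sums of length `p`. -/
theorem geom_sum_prime_pow {A : Type*} [CommRing A] (p m : ℕ) (u : A) :
    ∑ t ∈ Finset.range (p ^ m), u ^ t =
      ∏ i ∈ Finset.range m, ∑ s ∈ Finset.range p, (u ^ p ^ i) ^ s := by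
  have key : ∑ t ∈ Finset.range (p ^ m), (X : ℤ[X]) ^ t =
      ∏ i ∈ Finset.range m, ∑ s ∈ Finset.range p, ((X : ℤ[X]) ^ p ^ i) ^ s := by
    have h : ∀ m, (∏ i ∈ Finset.range m, ∑ s ∈ Finset.range p, ((X : ℤ[X]) ^ p ^ i) ^ s) * (X - 1) =
        X ^ p ^ m - 1 := by
      intro m
      induction m with
      | zero => simp
      | succ m ih =>
        rw [Finset.prod_range_succ, mul_right_comm, ih, mul_geom_sum, ← pow_mul, ← pow_succ]
    have hX : (X - 1 : ℤ[X]) ≠ 0 := X_sub_C_ne_zero 1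
    exact mul_right_cancel₀ hX (by rw [geom_sum_mul, h])
  simpa [map_sum, map_prod] using congrArg (aeval u) key

/-- If `ζ` has order `p` or `p ^ 2` (according as `e` is `0` or `1`), the roots of
`X ^ (p ^ i) - ζ ^ c` are among those of the geometric sum of length `p` in `X ^ (p ^ (i + e))`. -/
theorem prod_dvd_geom_sum_of_isPrimitiveRoot {p : ℕ} (hp : p.Prime) (k : ℕ) {e : ℕ} (he : e ≤ 1)
    {ζ : ℂ} (hζ : IsPrimitiveRoot ζ (p ^ (e + 1))) :
    (∏ i ∈ Finset.range k, ∏ c ∈ Finset.range (p - 1),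
      ((X : ℂ[X]) ^ p ^ i - C (ζ ^ (c + 1)))) ∣ ∑ t ∈ Finset.range (p ^ (k + 1)), X ^ t := by
  have hη : IsPrimitiveRoot (ζ ^ p ^ e) p :=
    hζ.pow (pow_pos hp.pos _) (pow_succ p e)
  have h1 : (∏ i ∈ Finset.range k, ∏ c ∈ Finset.range (p - 1),
      ((X : ℂ[X]) ^ p ^ i - C (ζ ^ (c + 1)))) ∣
      ∏ i ∈ Finset.range k, ∑ s ∈ Finset.range p, ((X : ℂ[X]) ^ p ^ (i + e)) ^ s := by
    refine Finset.prod_dvd_prod_of_dvd _ _ fun i _ => ?_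
    refine dvd_trans ?_ (prod_sub_pow_dvd_geom_sum hp hη (X ^ p ^ (i + e)))
    refine Finset.prod_dvd_prod_of_dvd _ _ fun c _ => ?_
    have := sub_dvd_pow_sub_pow ((X : ℂ[X]) ^ p ^ i) (C (ζ ^ (c + 1))) (p ^ e)
    rwa [← pow_mul, ← pow_add, ← C_pow, pow_right_comm] at this
  refine h1.trans ?_
  rw [geom_sum_prime_pow]
  interval_cases e
  · rw [Finset.prod_range_succ]; exact dvd_mul_right _ _
  · rw [Finset.prod_range_succ']; exact dvd_mul_right _ _

/-- If `w ^ (p ^ 2) = 1` in the strong sense that `1 + w + ⋯ + w ^ (p ^ 2 - 1) = 0`, then the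
`k (p - 1)` elements `u ^ (p ^ i) - w ^ c` with `i < k`, `1 ≤ c < p` jointly divide
`1 + u + ⋯ + u ^ (p ^ (k + 1) - 1)`. The universal case lives over `ℤ[w]`: the remainder of the
division by the monic (in `u`) product vanishes at `w = ζ_p` and at `w = ζ_{p ^ 2}`, hence is
divisible by the product of the two cyclotomic polynomials. -/
theorem prod_dvd_geom_sum {A : Type*} [CommRing A] {p : ℕ} (hp : p.Prime) (k : ℕ) (u w : A)
    (hw : ∑ t ∈ Finset.range (p ^ 2), w ^ t = 0) :
    (∏ i ∈ Finset.range k, ∏ c ∈ Finset.range (p - 1), (u ^ p ^ i - w ^ (c + 1))) ∣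
      ∑ t ∈ Finset.range (p ^ (k + 1)), u ^ t := by
  have : Fact p.Prime := ⟨hp⟩
  let D : ℤ[X][X] := ∏ i ∈ Finset.range k, ∏ c ∈ Finset.range (p - 1), (X ^ p ^ i - C (X ^ (c + 1)))
  let P : ℤ[X][X] := ∑ t ∈ Finset.range (p ^ (k + 1)), X ^ t
  have hD : D.Monic := monic_prod_of_monic _ _ fun i _ => monic_prod_of_monic _ _ fun c _ =>
    monic_X_pow_sub_C _ (pow_pos hp.pos i).ne'
  -- the remainder vanishes at a primitive root of unity of order `p` or `p ^ 2`
  have hroot : ∀ e ≤ 1, ∀ j, cyclotomic (p ^ (e + 1)) ℤ ∣ (P %ₘ D).coeff j := by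
    intro e he j
    have hpos : p ^ (e + 1) ≠ 0 := (pow_pos hp.pos _).ne'
    have hζ := Complex.isPrimitiveRoot_exp (p ^ (e + 1)) hpos
    set ζ := Complex.exp (2 * Real.pi * Complex.I / (p ^ (e + 1) : ℕ))
    have hdvd := prod_dvd_geom_sum_of_isPrimitiveRoot hp k he hζ
    let f : ℤ[X] →+* ℂ := (aeval ζ : ℤ[X] →ₐ[ℤ] ℂ).toRingHom
    have hfX : f X = ζ := aeval_X ζ
    have hDm : D.map f = ∏ i ∈ Finset.range k, ∏ c ∈ Finset.range (p - 1),
        ((X : ℂ[X]) ^ p ^ i - C (ζ ^ (c + 1))) := by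
      simp [D, Polynomial.map_prod, hfX]
    have hPm : P.map f = ∑ t ∈ Finset.range (p ^ (k + 1)), X ^ t := by
      simp [P, Polynomial.map_sum]
    have hr : (P %ₘ D).map f = 0 := by
      rw [map_modByMonic f hD, (modByMonic_eq_zero_iff_dvd (hD.map f)), hDm, hPm]
      exact hdvd
    have hz : aeval ζ ((P %ₘ D).coeff j) = 0 := by
      have := congrArg (fun q => q.coeff j) hr
      rwa [coeff_map, coeff_zero] at this
    rw [cyclotomic_eq_minpoly hζ (Nat.pos_of_ne_zero hpos)]
    exact minpoly.isIntegrallyClosed_dvd (hζ.isIntegral (Nat.pos_of_ne_zero hpos)) hz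
  have hgeom : cyclotomic (p ^ (0 + 1)) ℤ * cyclotomic (p ^ (1 + 1)) ℤ =
      ∑ t ∈ Finset.range (p ^ 2), X ^ t := by
    rw [geom_sum_prime_pow, cyclotomic_prime_pow_eq_geom_sum hp,
      cyclotomic_prime_pow_eq_geom_sum hp, Finset.prod_range_succ, Finset.prod_range_one]
  have hrel : IsRelPrime (cyclotomic (p ^ (0 + 1)) ℤ) (cyclotomic (p ^ (1 + 1)) ℤ) := by
    have h0 := cyclotomic.irreducible (pow_pos hp.pos (0 + 1))
    have h1 := cyclotomic.irreducible (pow_pos hp.pos (1 + 1))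
    refine (h0.isRelPrime_iff_not_dvd).2 fun h => ?_
    have heq := eq_of_monic_of_associated (cyclotomic.monic _ ℤ) (cyclotomic.monic _ ℤ)
      (h0.associated_of_dvd h1 h)
    have := cyclotomic_injective heq
    have := Nat.pow_right_injective hp.two_le this
    omega
  have hcoef : ∀ j, (∑ t ∈ Finset.range (p ^ 2), (X : ℤ[X]) ^ t) ∣ (P %ₘ D).coeff j := fun j =>
    hgeom ▸ hrel.mul_dvd (hroot 0 (by omega) j) (hroot 1 le_rfl j)
  -- specialise the universal identity at `u` and `w`
  let f : ℤ[X] →+* A := (aeval w : ℤ[X] →ₐ[ℤ] A).toRingHom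
  have hfX : f X = w := aeval_X w
  have hr : (P %ₘ D).map f = 0 := by
    ext j
    obtain ⟨q, hq⟩ := hcoef j
    rw [coeff_map, hq, map_mul, map_sum]
    simp [hfX, hw]
  have hPA : P.eval₂ f u = ∑ t ∈ Finset.range (p ^ (k + 1)), u ^ t := by
    simp [P, eval₂_finsetSum]
  have hDA : D.eval₂ f u =
      ∏ i ∈ Finset.range k, ∏ c ∈ Finset.range (p - 1), (u ^ p ^ i - w ^ (c + 1)) := by
    simp only [D, eval₂_finsetProd, eval₂_sub, eval₂_pow, eval₂_X, eval₂_C, map_pow, hfX]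
  have h := congrArg (eval₂ f u) (modByMonic_add_div P D)
  rw [eval₂_add, eval₂_mul, eval₂_eq_eval_map (p := P %ₘ D), hr, eval_zero, zero_add, hPA, hDA] at h
  exact ⟨_, h.symm⟩

end KuSS

/-! ### The shift operators on `N` -/

noncomputable section
namespace KuSS
open Polynomial

variable (p : ℕ) [Fact p.Prime]

/-- The shift `α_i ↦ α_{i-1}` of `F`. -/
def shift : Module.End (Ku p) (F p) :=
  Finsupp.linearCombination (Ku p) fun i : ℕ+ => alpha p ((i : ℤ) - 1)

variable {p}

theorem alpha_of_nonpos {h : ℤ} (hh : h ≤ 0) : alpha p h = 0 := if_neg (by omega)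

theorem alpha_coe (i : ℕ+) : alpha p (i : ℤ) = Finsupp.single i 1 := by
  have h : 0 < (i : ℤ) := by exact_mod_cast i.pos
  rw [alpha, if_pos h]
  congr 1
  exact PNat.coe_toPNat' i

theorem linearCombination_alpha (f : ℕ+ → F p) (h : ℤ) (hh : 0 < h) :
    ∃ i : ℕ+, (i : ℤ) = h ∧ Finsupp.linearCombination (Ku p) f (alpha p h) = f i := by
  obtain ⟨i, rfl⟩ : ∃ i : ℕ+, (i : ℤ) = h :=
    ⟨⟨h.toNat, by omega⟩, by simpa using hh.le⟩
  exact ⟨i, rfl, by rw [alpha_coe, Finsupp.linearCombination_single, one_smul]⟩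

theorem shift_alpha (h : ℤ) : shift p (alpha p h) = alpha p (h - 1) := by
  by_cases hh : 0 < h
  · obtain ⟨i, rfl, hi⟩ := linearCombination_alpha (p := p) (fun i : ℕ+ => alpha p ((i : ℤ) - 1)) h hh
    exact hi
  · rw [alpha_of_nonpos (by omega), alpha_of_nonpos (by omega), map_zero]

theorem shift_pow_alpha (t : ℕ) (h : ℤ) : (shift p ^ t) (alpha p h) = alpha p (h - t) := by
  induction t generalizing h with
  | zero => simp
  | succ t ih =>
    rw [pow_succ, Module.End.mul_apply, shift_alpha, ih]
    congr 1
    push_cast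
    ring

/-- The `[n]`-series divided by its variable is a geometric sum in `1 + v x`. -/
theorem geom_sum_one_add_smul {A : Type*} [Ring A] [Algebra (Ku p) A] (s : A) (n : ℕ) :
    ∑ t ∈ Finset.range n, (1 + v p • s) ^ t =
      ∑ t ∈ Finset.range n, ((n.choose (t + 1) : Ku p) * v p ^ t) • s ^ t := by
  have h := congrArg (aeval (v p • s)) (geom_sum_X_comp_X_add_one_eq_sum (R := ℤ) n)
  simp only [aeval_comp, map_sum, map_pow, map_add, map_one, aeval_X, map_mul, map_natCast] at h
  rw [add_comm, h]
  refine Finset.sum_congr rfl fun t _ => ?_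
  rw [_root_.smul_pow, mul_smul, Nat.cast_smul_eq_nsmul, nsmul_eq_mul]

theorem seriesMap_eq_geom_sum (n : ℕ) :
    seriesMap p n = ∑ t ∈ Finset.range (p ^ n), (1 + v p • shift p) ^ t := by
  refine Eq.trans ?_ (geom_sum_one_add_smul (shift p) (p ^ n)).symm
  refine Finsupp.lhom_ext' fun i => LinearMap.ext_ring ?_
  have h := alpha_coe (p := p) i
  simp only [LinearMap.comp_apply, Finsupp.lsingle_apply, ← h, LinearMap.sum_apply,
    LinearMap.smul_apply, shift_pow_alpha]
  rw [h, seriesMap, Finsupp.linearCombination_single, one_smul]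
  rfl

/-- The shift `e_j ↦ e_{j-1}` of `ku_*(ℤ_{p ^ n})`. -/
def shiftKuHom (p : ℕ) [Fact p.Prime] (n : ℕ) : Module.End (Ku p) (KuHom p n) :=
  Submodule.mapQ _ _ (shift p) (by
    rintro _ ⟨x, rfl⟩
    have h : Commute (shift p) (seriesMap p n) := by
      rw [seriesMap_eq_geom_sum]
      exact Commute.sum_right _ _ _ fun t _ => Commute.pow_right
        ((Commute.one_right _).add_right ((Commute.refl _).smul_right _)) t
    exact ⟨shift p x, (LinearMap.congr_fun h.eq x).symm⟩)

/-- The operator `[i, j] ↦ [i - 1, j]`. -/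
def opX (p : ℕ) [Fact p.Prime] (n : ℕ) : Module.End (Ku p) (N p n) :=
  (shift p).rTensor (KuHom p n)

/-- The operator `[i, j] ↦ [i, j - 1]`. -/
def opY (p : ℕ) [Fact p.Prime] (n : ℕ) : Module.End (Ku p) (N p n) :=
  (shiftKuHom p n).lTensor (F p)

theorem opX_bracket (n : ℕ) (i j : ℤ) : opX p n (bracket p n i j) = bracket p n (i - 1) j := by
  change shift p (alpha p i) ⊗ₜ[Ku p] e p n j = _
  rw [shift_alpha]
  rfl

theorem opY_bracket (n : ℕ) (i j : ℤ) : opY p n (bracket p n i j) = bracket p n i (j - 1) := by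
  change alpha p i ⊗ₜ[Ku p] (LinearMap.range (seriesMap p n)).mkQ (shift p (alpha p j)) = _
  rw [shift_alpha]
  rfl

theorem commute_opX_opY (n : ℕ) : Commute (opX p n) (opY p n) := by
  change (shift p).rTensor (KuHom p n) ∘ₗ (shiftKuHom p n).lTensor (F p) =
    (shiftKuHom p n).lTensor (F p) ∘ₗ (shift p).rTensor (KuHom p n)
  rw [LinearMap.rTensor_comp_lTensor, LinearMap.lTensor_comp_rTensor]

theorem bd_eq_geom_sum (n m : ℕ) :
    bd p n m = ∑ t ∈ Finset.range (p ^ m), (1 + v p • opX p n) ^ t := by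
  have h := congrArg (Module.End.rTensorAlgHom (Ku p) (F p) (KuHom p n))
    (seriesMap_eq_geom_sum (p := p) m)
  rw [map_sum] at h
  simp only [map_pow, map_add, map_one, map_smul] at h
  exact h

/-- The defining relations of `ku_*(ℤ_{p ^ n})`, as an identity of operators. -/
theorem geom_sum_opY (n : ℕ) :
    ∑ t ∈ Finset.range (p ^ n), (1 + v p • opY p n) ^ t = 0 := by
  have h1 : ∑ t ∈ Finset.range (p ^ n),
      (1 + v p • shiftKuHom p n : Module.End (Ku p) (KuHom p n)) ^ t = 0 := by
    have hpow : ∀ t : ℕ, ∀ x : F p, ((1 + v p • shiftKuHom p n : Module.End (Ku p) (KuHom p n)) ^ t)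
        ((LinearMap.range (seriesMap p n)).mkQ x) = (LinearMap.range (seriesMap p n)).mkQ
          (((1 + v p • shift p : Module.End (Ku p) (F p)) ^ t) x) := by
      intro t
      induction t with
      | zero => intro x; rfl
      | succ t ih =>
        intro x
        rw [pow_succ, pow_succ, Module.End.mul_apply, Module.End.mul_apply, ← ih]
        rfl
    refine LinearMap.ext fun y => ?_
    obtain ⟨x, rfl⟩ := Submodule.mkQ_surjective _ y
    rw [LinearMap.sum_apply, Finset.sum_congr rfl fun t _ => hpow t x, ← map_sum,
      ← LinearMap.sum_apply, ← seriesMap_eq_geom_sum]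
    exact (Submodule.Quotient.mk_eq_zero _).2 ⟨x, rfl⟩
  have h2 := congrArg (Module.End.lTensorAlgHom (Ku p) (KuHom p n) (F p)) h1
  rw [map_sum, map_zero] at h2
  simp only [map_pow, map_add, map_one, map_smul] at h2
  exact h2

/-- Nonzero residues modulo `p` are units of `ku_*`. -/
theorem isUnit_natCast {c : ℕ} (h0 : 0 < c) (hc : c < p) : IsUnit (c : Ku p) := by
  have hmem : ((c : ℤ)) ∈ (Ideal.span {(p : ℤ)}).primeCompl := by
    intro h
    have h := Ideal.mem_span_singleton.1 h
    exact absurd (Nat.le_of_dvd h0 (by exact_mod_cast h)) (by omega)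
  have h1 := IsLocalization.map_units (Localization.AtPrime (Ideal.span {(p : ℤ)})) ⟨(c : ℤ), hmem⟩
  have h2 := h1.map (Polynomial.C : Localization.AtPrime (Ideal.span {(p : ℤ)}) →+* _)
  simp only [map_natCast] at h2
  exact h2

end KuSS
end

/-! ### The filtration and the construction of cycles -/

noncomputable section
namespace KuSS
variable {p : ℕ} [Fact p.Prime]

theorem bracket_eq_zero_of_nonpos_left (n : ℕ) {i : ℤ} (j : ℤ) (hi : i ≤ 0) :
    bracket p n i j = 0 := by
  rw [bracket, alpha_of_nonpos hi]
  exact TensorProduct.zero_tmul _ _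

theorem bracket_eq_zero_of_nonpos_right (n : ℕ) (i : ℤ) {j : ℤ} (hj : j ≤ 0) :
    bracket p n i j = 0 := by
  rw [bracket, e, alpha_of_nonpos hj, map_zero]
  exact TensorProduct.tmul_zero _ _

theorem bracket_mem_fil (n k : ℕ) {i j w : ℤ} (hw : weight p k i j ≤ w) :
    bracket p n i j ∈ fil p n k w := by
  rcases lt_or_ge 0 i with hi | hi
  · rcases lt_or_ge 0 j with hj | hj
    · exact Submodule.subset_span ⟨i, j, hi, hj, hw, rfl⟩
    · rw [bracket_eq_zero_of_nonpos_right n i hj]; exact zero_mem _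
  · rw [bracket_eq_zero_of_nonpos_left n j hi]; exact zero_mem _

theorem fil_mono (n k : ℕ) {w w' : ℤ} (h : w ≤ w') : fil p n k w ≤ fil p n k w' :=
  Submodule.span_mono fun _ ⟨i, j, hi, hj, hw, hx⟩ => ⟨i, j, hi, hj, hw.trans h, hx⟩

theorem fil_le_iff (n k : ℕ) {w : ℤ} {M : Submodule (Ku p) (N p n)} :
    fil p n k w ≤ M ↔ ∀ i j : ℤ, 1 ≤ i → 1 ≤ j → weight p k i j ≤ w → bracket p n i j ∈ M := by
  refine Submodule.span_le.trans ⟨fun h i j hi hj hw => h ⟨i, j, hi, hj, hw, rfl⟩, ?_⟩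
  rintro h _ ⟨i, j, hi, hj, hw, rfl⟩
  exact h i j hi hj hw

theorem fil_eq_bot (n k : ℕ) {w : ℤ} (hw : w ≤ 0) : fil p n k w = ⊥ := by
  refine le_bot_iff.1 ((fil_le_iff n k).2 fun i j hi hj h => absurd h ?_)
  have : 0 < weight p k i j := by unfold weight; positivity
  omega

/-- The endomorphism `T` lowers the filtration by at least `d`. -/
def Lowers (n k : ℕ) (d : ℤ) (T : Module.End (Ku p) (N p n)) : Prop :=
  ∀ w, fil p n k w ≤ (fil p n k (w - d)).comap T

namespace Lowers
variable {n k : ℕ} {d d' : ℤ} {S T : Module.End (Ku p) (N p n)}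

theorem add (hS : Lowers n k d S) (hT : Lowers n k d T) : Lowers n k d (S + T) :=
  fun w _ hx => (fil p n k (w - d)).add_mem (hS w hx) (hT w hx)

theorem sub (hS : Lowers n k d S) (hT : Lowers n k d T) : Lowers n k d (S - T) :=
  fun w _ hx => (fil p n k (w - d)).sub_mem (hS w hx) (hT w hx)

theorem smul (r : Ku p) (hT : Lowers n k d T) : Lowers n k d (r • T) :=
  fun w _ hx => (fil p n k (w - d)).smul_mem r (hT w hx)

theorem sum {ι : Type*} (s : Finset ι) {f : ι → Module.End (Ku p) (N p n)}
    (hf : ∀ i ∈ s, Lowers n k d (f i)) : Lowers n k d (∑ i ∈ s, f i) := by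
  intro w x hx
  rw [Submodule.mem_comap, LinearMap.sum_apply]
  exact sum_mem fun i hi => hf i hi w hx

theorem mul (hS : Lowers n k d S) (hT : Lowers n k d' T) : Lowers n k (d + d') (S * T) := by
  intro w x hx
  have h := hS _ (hT w hx)
  rwa [sub_sub, add_comm d' d] at h

theorem mono (hT : Lowers n k d T) (h : d' ≤ d) : Lowers n k d' T :=
  fun w _ hx => fil_mono n k (by omega) (hT w hx)

theorem one : Lowers n k 0 (1 : Module.End (Ku p) (N p n)) := fun w x hx => by
  rw [sub_zero]; exact hx

theorem pow (hT : Lowers n k 0 T) (t : ℕ) : Lowers n k 0 (T ^ t) := by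
  induction t with
  | zero => exact one
  | succ t ih => rw [pow_succ]; exact (ih.mul hT).mono (add_zero 0).ge

theorem opX : Lowers n k ((p : ℤ) ^ (k + 1) + 1) (opX p n) := fun w =>
  (fil_le_iff n k).2 fun i j _ _ hw => by
    rw [Submodule.mem_comap, opX_bracket]
    exact bracket_mem_fil n k (by unfold weight at *; linarith)

theorem opY : Lowers n k ((p : ℤ) ^ k + 1) (opY p n) := fun w =>
  (fil_le_iff n k).2 fun i j _ _ hw => by
    rw [Submodule.mem_comap, opY_bracket]
    exact bracket_mem_fil n k (by unfold weight at *; linarith)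

theorem one_add_smul (hT : Lowers n k d T) (hd : 0 ≤ d) (r : Ku p) : Lowers n k 0 (1 + r • T) :=
  one.add ((hT.mono hd).smul r)

theorem geom_sum (hT : Lowers n k 0 T) (m : ℕ) : Lowers n k 0 (∑ t ∈ Finset.range m, T ^ t) :=
  sum _ fun t _ => hT.pow t

end Lowers

/-- The operator `[q](X) - [c](Y)`, where `[m](x) = x ∑_{t < m} (1 + v x) ^ t` is the `[m]`-series
of the multiplicative formal group law. -/
def seriesSub (p : ℕ) [Fact p.Prime] (n q c : ℕ) : Module.End (Ku p) (N p n) :=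
  opX p n * ∑ t ∈ Finset.range q, (1 + v p • opX p n) ^ t -
    opY p n * ∑ t ∈ Finset.range c, (1 + v p • opY p n) ^ t

/-- The leading term of `[q](X) - [c](Y)` is `-c Y`: the weight of `X` exceeds that of `Y`. -/
theorem lowers_seriesSub_add (n k q c : ℕ) :
    Lowers n k ((p : ℤ) ^ k + 1 + 1) (seriesSub p n q c + (c : Ku p) • opY p n) := by
  have hp : 2 ≤ p := (Fact.out : p.Prime).two_le
  have hpk : (0 : ℤ) < (p : ℤ) ^ k := by positivity
  have hpk' : (p : ℤ) ^ k < (p : ℤ) ^ (k + 1) := pow_lt_pow_right₀ (by exact_mod_cast hp) (by omega)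
  have hX := Lowers.opX (p := p) (n := n) (k := k)
  have hY := Lowers.opY (p := p) (n := n) (k := k)
  have h1 : seriesSub p n q c + (c : Ku p) • opY p n =
      opX p n * ∑ t ∈ Finset.range q, (1 + v p • opX p n) ^ t -
        opY p n * ∑ t ∈ Finset.range c, ((∑ s ∈ Finset.range t, (1 + v p • opY p n) ^ s) *
          (v p • opY p n)) := by
    have h2 : ∀ t : ℕ, (∑ s ∈ Finset.range t, (1 + v p • opY p n) ^ s) * (v p • opY p n) =
        (1 + v p • opY p n) ^ t - 1 := by
      intro t
      rw [← geom_sum_mul, add_sub_cancel_left]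
    have h3 : (c : Ku p) • opY p n = opY p n * (c : Module.End (Ku p) (N p n)) := by
      rw [Nat.cast_smul_eq_nsmul, nsmul_eq_mul']
    rw [Finset.sum_congr rfl fun t _ => h2 t, Finset.sum_sub_distrib, Finset.sum_const,
      Finset.card_range, nsmul_one, seriesSub, h3, mul_sub]
    abel
  rw [h1]
  have hX0 := (hX.one_add_smul (by omega) (v p)).geom_sum q
  refine ((hX.mul hX0).mono (by omega)).sub ?_
  refine (hY.mul (Lowers.sum _ fun t _ =>
    ((hY.one_add_smul (by omega) (v p)).geom_sum t).mul (hY.smul (v p)))).mono ?_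
  omega

/-- An operator with leading term a unit multiple of `Y` maps `F_{w + |Y|}` onto `F_w`: the leading
term is inverted by `[i, j] ↦ [i, j + 1]`, and the error has smaller weight. -/
theorem fil_le_map (n k : ℕ) {T : Module.End (Ku p) (N p n)} (r : (Ku p)ˣ)
    (hT : Lowers n k ((p : ℤ) ^ k + 1 + 1) (T + (r : Ku p) • opY p n)) (w : ℤ) :
    fil p n k w ≤ (fil p n k (w + ((p : ℤ) ^ k + 1))).map T := by
  suffices H : ∀ m : ℕ, fil p n k m ≤ (fil p n k (m + ((p : ℤ) ^ k + 1))).map T by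
    rcases le_total w 0 with hw | hw
    · rw [fil_eq_bot n k hw]; exact bot_le
    · lift w to ℕ using hw; exact H w
  intro m
  induction m with
  | zero => rw [fil_eq_bot n k (by simp)]; exact bot_le
  | succ m ih =>
    rw [fil_le_iff]
    intro i j hi hj hw
    have hmem : bracket p n i (j + 1) ∈ fil p n k ((m + 1 : ℕ) + ((p : ℤ) ^ k + 1)) :=
      bracket_mem_fil n k (by unfold weight at *; linarith)
    have hR : T (bracket p n i (j + 1)) + (r : Ku p) • bracket p n i j ∈ fil p n k m := by
      have h := hT _ hmem
      rw [Submodule.mem_comap, LinearMap.add_apply, LinearMap.smul_apply, opY_bracket,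
        add_sub_cancel_right] at h
      convert h using 2
      push_cast
      ring
    obtain ⟨s, hs, hTs⟩ := ih hR
    refine ⟨(↑r⁻¹ : Ku p) • (s - bracket p n i (j + 1)), Submodule.smul_mem _ _
      (sub_mem (fil_mono n k (by push_cast; omega) hs) hmem), ?_⟩
    rw [map_smul, map_sub, hTs, add_sub_cancel_left, smul_smul, Units.inv_mul, one_smul]

/-- Commuting operators `T_0, …, T_{m-1}`, each with leading term a unit multiple of `Y`: the product
kills some `[a, m] + low`. Commutativity is encoded by letting a commutative ring act. -/
theorem exists_low_prod_eq_zero (n k : ℕ) {S : Type*} [CommRing S]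
    (φ : S →+* Module.End (Ku p) (N p n)) (T : ℕ → S) (m : ℕ) (a : ℤ)
    (hT : ∀ l < m, ∃ r : (Ku p)ˣ,
      Lowers n k ((p : ℤ) ^ k + 1 + 1) (φ (T l) + (r : Ku p) • opY p n)) :
    ∃ low ∈ fil p n k (weight p k a m - 1),
      φ (∏ l ∈ Finset.range m, T l) (bracket p n a m + low) = 0 := by
  induction m with
  | zero =>
    exact ⟨0, zero_mem _, by rw [bracket_eq_zero_of_nonpos_right n a (by simp), add_zero, map_zero]⟩
  | succ m ih =>
    obtain ⟨low, hlow, h0⟩ := ih fun l hl => hT l (by omega)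
    obtain ⟨r, hr⟩ := hT m (by omega)
    have hwt : weight p k a (m + 1 : ℕ) = weight p k a m + ((p : ℤ) ^ k + 1) := by
      unfold weight; push_cast; ring
    have hR : φ (T m) (bracket p n a (m + 1 : ℕ)) + (r : Ku p) • bracket p n a m ∈
        fil p n k (weight p k a m - 1) := by
      have h := hr _ (bracket_mem_fil n k (le_refl (weight p k a (m + 1 : ℕ))))
      rw [Submodule.mem_comap, LinearMap.add_apply, LinearMap.smul_apply, opY_bracket, hwt,
        Nat.cast_succ, add_sub_cancel_right] at h
      rw [Nat.cast_succ]
      convert h using 2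
      ring
    -- choose the correction so that `T_m` sends the new element to `-r` times the old one
    obtain ⟨s, hs, hTs⟩ := fil_le_map n k r hr _
      (add_mem hR (Submodule.smul_mem _ (r : Ku p) hlow))
    refine ⟨-s, neg_mem ?_, ?_⟩
    · rw [hwt, add_sub_right_comm]
      exact hs
    have h1 : φ (T m) (bracket p n a (m + 1 : ℕ) + -s) =
        -((r : Ku p) • (bracket p n a m + low)) := by
      rw [map_add, map_neg, hTs, smul_add]
      abel
    rw [Finset.prod_range_succ, map_mul, Module.End.mul_apply, h1, map_neg, map_smul, h0,
      smul_zero, neg_zero]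

theorem prod_range_mul_div_mod {M : Type*} [CommMonoid M] (f : ℕ → ℕ → M) (k q : ℕ) :
    ∏ l ∈ Finset.range (k * q), f (l / q) (l % q) =
      ∏ i ∈ Finset.range k, ∏ c ∈ Finset.range q, f i c := by
  induction k with
  | zero => simp
  | succ k ih =>
    rw [Nat.succ_mul, Finset.prod_range_add, ih, Finset.prod_range_succ]
    congr 1
    refine Finset.prod_congr rfl fun c hc => ?_
    have hc := Finset.mem_range.1 hc
    rw [mul_comm k q, Nat.mul_add_div (by omega), Nat.div_eq_of_lt hc, Nat.mul_add_mod,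
      Nat.mod_eq_of_lt hc, add_zero]

open scoped IsMulCommutative in
/-- The prefix of length `b` of the `k (p - 1)` factors `[p ^ i](X) - [c](Y)` kills some
`[a, b] + low`, and `v ^ (k (p - 1))` times the full product divides `∂_{k+1}`. -/
theorem exists_low_bd_eq_zero (k : ℕ) (a : ℤ) {b : ℕ} (hb : b ≤ k * g p 1) :
    ∃ low ∈ fil p 2 k (weight p k a b - 1), bd p 2 (k + 1) (bracket p 2 a b + low) = 0 := by
  have hp : p.Prime := Fact.out
  have hg : g p 1 = p - 1 := by rw [g, pow_one]
  rw [hg] at hb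
  have hcomm := commute_opX_opY (p := p) 2
  -- the subalgebra generated by `X` and `Y` is commutative; `x`, `y`, `s` are `X`, `Y`, `v` in it
  let S := Algebra.adjoin (Ku p) ({opX p 2, opY p 2} : Set (Module.End (Ku p) (N p 2)))
  have : IsMulCommutative S := Algebra.isMulCommutative_adjoin (Ku p) (by
    rintro _ (rfl | rfl) _ (rfl | rfl)
    exacts [rfl, hcomm.eq, hcomm.eq.symm, rfl])
  let φ : S →+* Module.End (Ku p) (N p 2) := S.val.toRingHom
  have hφ : Function.Injective φ := Subtype.val_injective
  let x : S := ⟨opX p 2, Algebra.subset_adjoin (by simp)⟩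
  let y : S := ⟨opY p 2, Algebra.subset_adjoin (by simp)⟩
  let s : S := ⟨v p • 1, Subalgebra.smul_mem _ (one_mem _) _⟩
  have hu : φ (1 + s * x) = 1 + v p • opX p 2 := by
    change 1 + (v p • (1 : Module.End (Ku p) (N p 2))) * opX p 2 = _
    rw [smul_one_mul]
  have hw : φ (1 + s * y) = 1 + v p • opY p 2 := by
    change 1 + (v p • (1 : Module.End (Ku p) (N p 2))) * opY p 2 = _
    rw [smul_one_mul]
  let T : ℕ → ℕ → S := fun i c => x * ∑ t ∈ Finset.range (p ^ i), (1 + s * x) ^ t -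
    y * ∑ t ∈ Finset.range (c + 1), (1 + s * y) ^ t
  have hT : ∀ i c, φ (T i c) = seriesSub p 2 (p ^ i) (c + 1) := by
    intro i c
    have hx' : φ x = opX p 2 := rfl
    have hy' : φ y = opY p 2 := rfl
    simp only [T, map_sub, map_mul, map_sum, map_pow, hu, hw, hx', hy', seriesSub]
  have hsT : ∀ i c, s * T i c = (1 + s * x) ^ p ^ i - (1 + s * y) ^ (c + 1) := by
    intro i c
    have h1 := mul_geom_sum (1 + s * x) (p ^ i)
    have h2 := mul_geom_sum (1 + s * y) (c + 1)
    simp only [T]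
    linear_combination h1 - h2
  have hw0 : ∑ t ∈ Finset.range (p ^ 2), (1 + s * y) ^ t = 0 := hφ (by
    rw [map_sum, map_zero, ← geom_sum_opY (p := p) 2]
    simp only [map_pow, hw])
  -- the factors are listed in one sequence, the index `l` standing for `i = l / (p - 1)` and
  -- `c = l % (p - 1) + 1`
  obtain ⟨low, hlow, h0⟩ := exists_low_prod_eq_zero 2 k φ
    (fun l => T (l / (p - 1)) (l % (p - 1))) b a (by
      intro l hl
      have hlt : l % (p - 1) < p - 1 := Nat.mod_lt _ (by have := hp.two_le; omega)
      refine ⟨(isUnit_natCast (p := p) (Nat.succ_pos (l % (p - 1))) (by omega)).unit, ?_⟩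
      rw [hT]
      exact lowers_seriesSub_add 2 k _ _)
  refine ⟨low, hlow, ?_⟩
  have hdvd : (∏ l ∈ Finset.range b, T (l / (p - 1)) (l % (p - 1))) ∣
      ∑ t ∈ Finset.range (p ^ (k + 1)), (1 + s * x) ^ t := by
    refine ((Finset.prod_dvd_prod_of_subset _ _ _ (Finset.range_mono hb)).trans ?_).trans
      (prod_dvd_geom_sum hp k (1 + s * x) (1 + s * y) hw0)
    rw [prod_range_mul_div_mod]
    exact Finset.prod_dvd_prod_of_dvd _ _ fun i _ => Finset.prod_dvd_prod_of_dvd _ _ fun c _ =>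
      ⟨s, by rw [← hsT, mul_comm]⟩
  obtain ⟨q, hq⟩ := hdvd
  have hbd : bd p 2 (k + 1) = φ q * φ (∏ l ∈ Finset.range b, T (l / (p - 1)) (l % (p - 1))) := by
    rw [← map_mul, mul_comm q, ← hq, map_sum, bd_eq_geom_sum]
    simp only [map_pow, hu]
  rw [hbd, Module.End.mul_apply, h0, map_zero]

/-- An element with a cycle in its class modulo lower filtration is a permanent cycle. -/
theorem isPermanentCycle_of_bd_eq_zero (n k : ℕ) {w : ℤ} {x low : N p n} (hx : x ∈ fil p n k w)
    (hlow : low ∈ fil p n k (w - 1)) (h : bd p n (k + 1) (x + low) = 0) :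
    IsPermanentCycle p n k w x := by
  refine ⟨hx, fun r => ⟨⟨x + low, add_mem hx (fil_mono n k (by omega) hlow), ?_⟩, ?_, ?_⟩⟩
  · rw [Submodule.comap_coe, Set.mem_preimage, h]
    exact zero_mem _
  · rwa [add_sub_cancel_left]
  · have h0 : bdCyc p n k r w ⟨x + low, add_mem hx (fil_mono n k (by omega) hlow), by
        rw [Submodule.comap_coe, Set.mem_preimage, h]; exact zero_mem _⟩ = 0 := Subtype.ext h
    exact (congrArg (Submodule.Quotient.mk) h0).trans (Submodule.Quotient.mk_zero _)

end KuSS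
end

theorem mainTheorem3 (p : ℕ) [Fact p.Prime] (k : ℕ) (hk : 2 ≤ k) (a : ℕ) (ha : 1 ≤ a) :
    (∃ low ∈ KuSS.fil p 2 k (KuSS.weight p k a (k * KuSS.g p 1 : ℕ) - 1),
      KuSS.bd p 2 (k + 1) (KuSS.bracket p 2 a (k * KuSS.g p 1 : ℕ) + low) = 0) ∧
    (∀ b : ℕ, 1 ≤ b → b ≤ k * KuSS.g p 1 →
      KuSS.IsPermanentCycle p 2 k (KuSS.weight p k a b) (KuSS.bracket p 2 a b)) := by
  refine ⟨KuSS.exists_low_bd_eq_zero k a le_rfl, fun b _ hb => ?_⟩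
  obtain ⟨low, hlow, h⟩ := KuSS.exists_low_bd_eq_zero (p := p) k a hb
  exact KuSS.isPermanentCycle_of_bd_eq_zero 2 k (KuSS.bracket_mem_fil 2 k le_rfl) hlow h
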